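/- Call a sequence $\langle f_n\rangle$ of complex polynomials weakly convergent to the formal power series $f=\sum_k c_kz^k$ if $\lim_{n\to\infty}f_n^{(k)}(0)=k!\,c_k$ for every integer $k\ge 0$. The genus of an entire function $g\not\equiv 0$ is the least integer $h\ge 0$ such that $$g(z)=z^m e^{Q(z)}\prod_j\left(1-\frac z{a_j}\right)\exp\left(\sum_{k=1}^{h}\frac1k\left(\frac z{a_j}\right)^k\right)\qquad(z\in\mathbb C)$$ with an integer $m\ge 0$, a polynomial $Q$ of degree at most $h$, and finitely or countably many $a_j\in\mathbb C\setminus\{0\}$ with $\sum_j|a_j|^{-(h+1)}<\infty$ (and it is $\infty$ if there is no such $h$). For an entire function $\varphi$ let $\mathcal Z(\varphi)$ be the set of its zeros, with $\mathcal Z(\varphi)=\emptyset$ if $\varphi\equiv 0$. **Theorem 2.4.** Let $p$ be a positive integer and let $\langle f_n\rangle$ be a sequence of complex polynomials that converges weakly to the formal power series $f$. Suppose that $\lim_{n\to\infty}f_n(0)\neq 0$ and that for every $n$ all $z\in\mathcal Z(f_n)$ satisfy $\operatorname{Re}(z^p)\ge 0$. Then $f$ has infinite radius of convergence, so that it represents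 an entire function, again denoted by $f$; $f_n\to f$ uniformly on compact subsets of $\mathbb C$; all $z\in\mathcal Z(f)$ satisfy $\operatorname{Re}(z^p)\ge 0$; and $f$ is of the form $$f(z)=e^{\alpha z^{2p}}g(z)\qquad(z\in\mathbb C),$$ where $\alpha\in\mathbb C$ is a constant and $g$ is an entire function of genus at most $2p-1$. -/

import Mathlib

open Filter Topology

noncomputable section

/-- The zero set of a complex function; by convention it is empty when the function vanishes
identically. -/
def zeroSet (f : ℂ → ℂ) : Set ℂ := {z | f ≠ 0 ∧ f z = 0}

/-- The set of all complex `z` such that `z ^ p` lies in the closed right half plane. -/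
def rightHalfPlaneRoot (p : ℕ) : Set ℂ := {z | 0 ≤ (z ^ p).re}

/-- The sequence `F` of polynomials converges weakly to the formal power series `f`: for every `k`
the sequence of `k`-th derivatives at `0` converges, and its limit divided by `k!` is the `k`-th
coefficient of `f`. -/
def WeaklyConverges (F : ℕ → Polynomial ℂ) (f : PowerSeries ℂ) : Prop :=
  ∀ k : ℕ, Tendsto (fun n => iteratedDeriv k (fun z : ℂ => (F n).eval z) 0) atTop
    (𝓝 ((k.factorial : ℂ) * PowerSeries.coeff k f))

/-- The function `φ` is the sum of the formal power series `f` on the whole plane (so the radius of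
convergence of `f` is infinite and `φ` is entire). -/
def Represents (f : PowerSeries ℂ) (φ : ℂ → ℂ) : Prop :=
  Differentiable ℂ φ ∧ ∀ z : ℂ, HasSum (fun k : ℕ => PowerSeries.coeff k f * z ^ k) (φ z)

/-- Uniform convergence on all compact subsets of the complex plane. -/
def StronglyConverges (F : ℕ → ℂ → ℂ) (φ : ℂ → ℂ) : Prop :=
  ∀ K : Set ℂ, IsCompact K → TendstoUniformlyOn F φ atTop K

/-- The Weierstrass elementary factor `(1 - w) exp (w + w ^ 2 / 2 + ⋯ + w ^ h / h)`. -/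
def elementaryFactor (h : ℕ) (w : ℂ) : ℂ :=
  (1 - w) * Complex.exp (∑ k ∈ Finset.Icc 1 h, w ^ k / (k : ℂ))

/-- `g` has a Hadamard product of rank and degree at most `h`:
`g z = z ^ m * exp (Q z) * ∏ i, E_h (z / a i)` for all `z`, where `Q` is a polynomial of degree at
most `h` and `a` is a finite or countably infinite family of nonzero complex numbers such that
`∑ i, |a i| ^ (-(h + 1))` converges. -/
def HasHadamardProduct (g : ℂ → ℂ) (h : ℕ) : Prop :=
  ∃ (m : ℕ) (Q : Polynomial ℂ) (ι : Type) (_ : Countable ι) (a : ι → ℂ),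
    Q.natDegree ≤ h ∧ (∀ i, a i ≠ 0) ∧ Summable (fun i => (‖a i‖ ^ (h + 1))⁻¹) ∧
    ∀ z : ℂ, ∃ P : ℂ, HasProd (fun i => elementaryFactor h (z / a i)) P ∧
      g z = z ^ m * Complex.exp (Q.eval z) * P

/-- The genus of an entire function: the least `h` for which it has a Hadamard product as in
`HasHadamardProduct`, and `⊤` if there is none. -/
def genus (g : ℂ → ℂ) : ℕ∞ := ⨅ (h : ℕ) (_ : HasHadamardProduct g h), (h : ℕ∞)

end

open Filter Topology

/-! Write each polynomial as `F n = F n (0) * ∏ (1 - b n j z)`. Newton's identities express power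
sums of the inverse roots through the coefficients, so every power sum of order at least 1 converges
(`exists_tendsto_powerSum`). As `Re (b ^ p) ≥ 0`, the power sums of orders `p` and `2p` bound `∑ |b|
^ (2p)` uniformly in `n` (`sum_norm_pow_two_mul_le`). Rewriting the product with elementary factors
then bounds `F n` locally uniformly, and coefficientwise convergence becomes uniform convergence on
compacts.

For the shape of the limit, the inverse roots are sorted by decreasing modulus and a subsequence
converges in each position to some `β j`. The products of factors of rank `2p` converge by dominated
convergence (`exists_limit_canonicalProduct`). Since `∑ |β j| ^ (2p)` is finite, the rank drops to
`2p - 1`, and the surplus exponentials join the factor `exp (α z ^ (2p))`. -/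

/-! ### Weierstrass elementary factors -/

theorem elementaryFactor_zero (h : ℕ) : elementaryFactor h 0 = 1 := by
  have : ∑ k ∈ Finset.Icc 1 h, (0 : ℂ) ^ k / (k : ℂ) = 0 :=
    Finset.sum_eq_zero fun k hk => by
      rw [zero_pow (by have := (Finset.mem_Icc.1 hk).1; omega), zero_div]
  simp [elementaryFactor, this]

theorem elementaryFactor_succ (h : ℕ) (w : ℂ) :
    elementaryFactor (h + 1) w =
      elementaryFactor h w * Complex.exp (w ^ (h + 1) / ((h + 1 : ℕ) : ℂ)) := by
  rw [elementaryFactor, elementaryFactor, Finset.sum_Icc_succ_top (by omega), Complex.exp_add,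
    mul_assoc]

theorem continuous_elementaryFactor (h : ℕ) : Continuous (elementaryFactor h) := by
  unfold elementaryFactor; fun_prop

theorem elementaryFactor_ne_zero {h : ℕ} {w : ℂ} (hw : w ≠ 1) : elementaryFactor h w ≠ 0 :=
  mul_ne_zero (sub_ne_zero.2 hw.symm) (Complex.exp_ne_zero _)

theorem hasDerivAt_elementaryFactor (h : ℕ) (w : ℂ) :
    HasDerivAt (elementaryFactor h)
      (-w ^ h * Complex.exp (∑ k ∈ Finset.Icc 1 h, w ^ k / (k : ℂ))) w := by
  have hs : HasDerivAt (fun w : ℂ => ∑ k ∈ Finset.Icc 1 h, w ^ k / (k : ℂ))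
      (∑ k ∈ Finset.range h, w ^ k) w := by
    have := HasDerivAt.fun_sum (u := Finset.Icc 1 h) (A := fun k (w : ℂ) => w ^ k / (k : ℂ))
      (A' := fun k => w ^ (k - 1)) (x := w) fun k hk => by
        have hk0 : (k : ℂ) ≠ 0 := by
          have := (Finset.mem_Icc.1 hk).1
          exact_mod_cast (by omega : k ≠ 0)
        have := (hasDerivAt_pow k w).div_const (k : ℂ)
        rwa [mul_div_cancel_left₀ _ hk0] at this
    refine this.congr_deriv ?_
    symm
    rw [Finset.range_eq_Ico, Finset.sum_Ico_eq_sum_range, ← Finset.Ico_add_one_right_eq_Icc,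
      Finset.sum_Ico_eq_sum_range]
    simp
  have := ((hasDerivAt_id w).const_sub 1).mul hs.cexp
  refine this.congr_deriv ?_
  have hg := mul_neg_geom_sum w h
  simp only [id]
  linear_combination Complex.exp (∑ k ∈ Finset.Icc 1 h, w ^ k / (k : ℂ)) * hg

/-- The derivative is `-w ^ h` times an exponential bounded on the disc; the mean value inequality
from `0` to `w` supplies the extra power. -/
theorem exists_norm_elementaryFactor_sub_one_le (h : ℕ) (R : ℝ) :
    ∃ C, 0 ≤ C ∧ ∀ w : ℂ, ‖w‖ ≤ R → ‖elementaryFactor h w - 1‖ ≤ C * ‖w‖ ^ (h + 1) := by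
  refine ⟨Real.exp (∑ k ∈ Finset.Icc 1 h, R ^ k / (k : ℝ)), (Real.exp_pos _).le, fun w hw => ?_⟩
  have := (convex_closedBall (0 : ℂ) ‖w‖).norm_image_sub_le_of_norm_hasDerivWithin_le
    (f := elementaryFactor h) (C := Real.exp (∑ k ∈ Finset.Icc 1 h, R ^ k / (k : ℝ)) * ‖w‖ ^ h)
    (x := 0) (y := w) (fun x _ => (hasDerivAt_elementaryFactor h x).hasDerivWithinAt)
    (fun x hx => ?_) (by simp) (by simp)
  · rw [elementaryFactor_zero, sub_zero] at this
    rwa [pow_succ, ← mul_assoc]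
  · rw [mem_closedBall_zero_iff] at hx
    rw [norm_mul, norm_neg, norm_pow, mul_comm]
    gcongr
    refine (Complex.norm_exp_le_exp_norm _).trans (Real.exp_le_exp.2 ?_)
    refine (norm_sum_le _ _).trans (Finset.sum_le_sum fun k _ => ?_)
    rw [norm_div, norm_pow, Complex.norm_natCast]
    gcongr
    exact hx.trans hw

theorem prod_one_sub_eq_exp_mul_prod_elementaryFactor (h : ℕ) (s : Finset ℕ) (b : ℕ → ℂ) (z : ℂ) :
    ∏ j ∈ s, (1 - z * b j) =
      Complex.exp (-∑ k ∈ Finset.Icc 1 h, (∑ j ∈ s, b j ^ k) * z ^ k / (k : ℂ)) *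
        ∏ j ∈ s, elementaryFactor h (z * b j) := by
  simp only [elementaryFactor, Finset.prod_mul_distrib]
  rw [mul_left_comm, ← Complex.exp_sum, ← Complex.exp_add, Finset.sum_comm,
    ← Finset.sum_neg_distrib, ← Finset.sum_add_distrib, Finset.sum_eq_zero, Complex.exp_zero,
    mul_one]
  intro k _
  rw [Finset.sum_mul, Finset.sum_div, neg_add_eq_zero]
  exact Finset.sum_congr rfl fun j _ => by rw [mul_pow, mul_comm]

/-! ### Inverse roots and Newton's identities -/

-- The logarithmic derivative of the product, with the geometric series of each factor expanded and
-- denominators cleared.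
open Polynomial in
theorem derivative_prod_one_sub (s : Finset ℕ) (b : ℕ → ℂ) :
    ((derivative (∏ j ∈ s, (1 - C (b j) * X)) : ℂ[X]) : PowerSeries ℂ) =
      -((∏ j ∈ s, (1 - C (b j) * X) : ℂ[X]) : PowerSeries ℂ) *
        PowerSeries.mk fun k => ∑ j ∈ s, b j ^ (k + 1) := by
  classical
  induction s using Finset.induction_on with
  | empty =>
    have : (PowerSeries.mk fun _ => (0 : ℂ)) = 0 := by ext; simp
    simp [this]
  | insert i s hi ih =>
    have hgeom : (1 - PowerSeries.C (b i) * PowerSeries.X) *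
        (PowerSeries.mk fun k => b i ^ (k + 1)) = PowerSeries.C (b i) := by
      ext m
      rw [sub_mul, one_mul, mul_assoc, map_sub, PowerSeries.coeff_C_mul, PowerSeries.coeff_mk]
      rcases m with _ | m
      · simp
      · simp [PowerSeries.coeff_succ_X_mul, pow_succ']
    have hadd : (PowerSeries.mk fun k => ∑ j ∈ insert i s, b j ^ (k + 1)) =
        (PowerSeries.mk fun k => b i ^ (k + 1)) +
          PowerSeries.mk fun k => ∑ j ∈ s, b j ^ (k + 1) := by
      ext m; simp [Finset.sum_insert hi]
    rw [Finset.prod_insert hi, derivative_mul, hadd]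
    push_cast
    rw [ih]
    simp only [derivative_sub, derivative_one, derivative_C_mul, derivative_X, mul_one, zero_sub]
    push_cast
    linear_combination ((∏ x ∈ s, (1 - C (b x) * X) : ℂ[X]) : PowerSeries ℂ) * hgeom

/-- Newton's identities for a polynomial written in terms of its inverse roots. -/
theorem newton_of_eq_prod {P : Polynomial ℂ} {a : ℂ} {s : Finset ℕ} {b : ℕ → ℂ}
    (hP : P = Polynomial.C a * ∏ j ∈ s, (1 - Polynomial.C (b j) * Polynomial.X)) (m : ℕ) :
    P.coeff (m + 1) * (m + 1) =
      -∑ i ∈ Finset.range (m + 1), P.coeff i * ∑ j ∈ s, b j ^ (m - i + 1) := by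
  have hd := congrArg (PowerSeries.coeff m)
    (congrArg (fun G => PowerSeries.C a * G) (derivative_prod_one_sub s b))
  have h1 : (PowerSeries.C a * ((Polynomial.derivative
      (∏ j ∈ s, (1 - Polynomial.C (b j) * Polynomial.X))) : PowerSeries ℂ)) =
      (Polynomial.derivative P : PowerSeries ℂ) := by
    rw [hP, Polynomial.derivative_C_mul]; push_cast; rfl
  have h2 : PowerSeries.C a * (-((∏ j ∈ s, (1 - Polynomial.C (b j) * Polynomial.X) :
      Polynomial ℂ) : PowerSeries ℂ) * PowerSeries.mk fun k => ∑ j ∈ s, b j ^ (k + 1)) =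
      -((P : PowerSeries ℂ) * PowerSeries.mk fun k => ∑ j ∈ s, b j ^ (k + 1)) := by
    rw [hP]; push_cast; ring
  rw [h1, h2, Polynomial.coeff_coe, Polynomial.coeff_derivative, map_neg, PowerSeries.coeff_mul,
    Finset.Nat.sum_antidiagonal_eq_sum_range_succ_mk] at hd
  simpa using hd

theorem exists_sorted_enumeration (s : Multiset ℂ) :
    ∃ b : ℕ → ℂ, (∀ j, s.card ≤ j → b j = 0) ∧ Antitone (fun j => ‖b j‖) ∧
      (Multiset.range s.card).map b = s := by
  let r : ℂ → ℂ → Prop := fun x y => ‖y‖ ≤ ‖x‖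
  have : DecidableRel r := Classical.decRel r
  have : Std.Total r := ⟨fun x y => le_total _ _⟩
  have : IsTrans ℂ r := ⟨fun x y z h1 h2 => le_trans h2 h1⟩
  set l := s.toList.insertionSort r with hl
  have hlen : l.length = s.card := by simp [hl]
  have hsort : l.Pairwise r := List.pairwise_insertionSort r _
  have hout : ∀ j, s.card ≤ j → l.getD j 0 = 0 := fun j hj => by
    rw [List.getD_eq_default _ _ (hlen ▸ hj)]
  -- Padding by `0` keeps the moduli decreasing, and a zero inverse root contributes the factor 1.
  refine ⟨fun j => l.getD j 0, hout, fun i j hij => ?_, ?_⟩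
  · rcases lt_or_ge j l.length with hj | hj
    · rcases hij.eq_or_lt with rfl | hij
      · exact le_rfl
      simp only [List.getD_eq_getElem _ _ hj, List.getD_eq_getElem _ _ (hij.trans hj)]
      exact List.pairwise_iff_getElem.1 hsort i j _ hj hij
    · simp only [hout j (hlen ▸ hj), norm_zero, norm_nonneg]
  · have : (List.range s.card).map (fun j => l.getD j 0) = l := by
      refine List.ext_getElem (by simp [hlen]) fun i h1 h2 => ?_
      rw [List.getElem_map, List.getElem_range, List.getD_eq_getElem _ _ h2]
    rw [← Multiset.coe_range, Multiset.map_coe, this]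
    refine (Multiset.coe_eq_coe.2 (List.perm_insertionSort r _)).trans s.coe_toList

open Polynomial in
theorem exists_sorted_inverse_roots (P : ℂ[X]) (hP : P.eval 0 ≠ 0) :
    ∃ (N : ℕ) (b : ℕ → ℂ), (∀ j, N ≤ j → b j = 0) ∧ Antitone (fun j => ‖b j‖) ∧
      P = C (P.eval 0) * ∏ j ∈ Finset.range N, (1 - C (b j) * X) := by
  obtain ⟨b, hb0, hbm, hbs⟩ := exists_sorted_enumeration (P.roots.map fun a => a⁻¹)
  refine ⟨_, b, hb0, hbm, ?_⟩
  have hP0 : P ≠ 0 := by rintro rfl; simp at hP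
  have hprod : ∏ j ∈ Finset.range (P.roots.map fun a => a⁻¹).card, (1 - C (b j) * X) =
      (P.roots.map fun a => 1 - C a⁻¹ * X).prod := by
    conv_rhs => rw [show (fun a : ℂ => 1 - C a⁻¹ * X) =
      (fun c : ℂ => (1 - C c * X : ℂ[X])) ∘ fun a => a⁻¹ from rfl, ← Multiset.map_map, ← hbs,
      Multiset.map_map]
    rfl
  have hfac : P = C P.leadingCoeff * (P.roots.map fun a => X - C a).prod :=
    (IsAlgClosed.splits P).eq_prod_roots
  have hfac' : P = C (P.leadingCoeff * (P.roots.map fun a => -a).prod) *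
      (P.roots.map fun a => 1 - C a⁻¹ * X).prod := by
    conv_lhs => rw [hfac]
    rw [C_mul, mul_assoc]
    congr 1
    rw [map_multiset_prod, Multiset.map_map, ← Multiset.prod_map_mul]
    congr 1
    refine Multiset.map_congr rfl fun a ha => ?_
    have ha0 : a ≠ 0 := by
      rintro rfl
      exact hP (mem_roots hP0 |>.1 ha)
    have : C a * C a⁻¹ = (1 : ℂ[X]) := by rw [← C_mul, mul_inv_cancel₀ ha0, C_1]
    simp only [Function.comp, C_neg]
    linear_combination (-X : ℂ[X]) * this
  rw [hprod]
  conv_lhs => rw [hfac']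
  congr 2
  conv_rhs => rw [hfac']
  simp [eval_mul, eval_multiset_prod]

/-! ### Power sums, local bounds and uniform convergence -/

theorem iteratedDeriv_eval_zero (P : Polynomial ℂ) (k : ℕ) :
    iteratedDeriv k (fun z : ℂ => P.eval z) 0 = (k.factorial : ℂ) * P.coeff k := by
  have h : ∀ k, iteratedDeriv k (fun z : ℂ => P.eval z) =
      fun z => (Polynomial.derivative^[k] P).eval z := by
    intro k
    induction k with
    | zero => simp
    | succ k ih =>
      funext z
      rw [iteratedDeriv_succ, ih, Polynomial.deriv, Function.iterate_succ_apply']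
  rw [h]
  beta_reduce
  rw [← Polynomial.coeff_zero_eq_eval_zero, Polynomial.coeff_iterate_derivative, zero_add,
    Nat.descFactorial_self, nsmul_eq_mul]

theorem norm_coeff_le_of_norm_eval_le (P : Polynomial ℂ) {R A : ℝ} (hR : 0 < R)
    (hA : ∀ z : ℂ, ‖z‖ ≤ R → ‖P.eval z‖ ≤ A) (k : ℕ) : ‖P.coeff k‖ ≤ A / R ^ k := by
  have := Complex.norm_iteratedDeriv_le_of_forall_mem_sphere_norm_le (c := 0) k hR
    (f := fun z => P.eval z) (P.differentiable.diffContOnCl)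
    (fun z hz => hA z (mem_sphere_zero_iff_norm.1 hz).le)
  rw [iteratedDeriv_eval_zero, norm_mul, Complex.norm_natCast, mul_div_assoc] at this
  exact le_of_mul_le_mul_left this (by exact_mod_cast k.factorial_pos)

theorem exists_norm_le_of_tendsto {u : ℕ → ℂ} {a : ℂ} (hu : Tendsto u atTop (𝓝 a)) :
    ∃ A, 0 ≤ A ∧ ∀ n, ‖u n‖ ≤ A := by
  obtain ⟨A, hA⟩ := (Metric.isBounded_range_of_tendsto u hu).exists_norm_le
  exact ⟨A, (norm_nonneg _).trans (hA _ ⟨0, rfl⟩), fun n => hA _ ⟨n, rfl⟩⟩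

theorem exists_tendsto_powerSum {F : ℕ → Polynomial ℂ} {c : ℕ → ℂ}
    (hF : ∀ k, Tendsto (fun n => (F n).coeff k) atTop (𝓝 (c k))) (hc : c 0 ≠ 0)
    {N : ℕ → ℕ} {b : ℕ → ℕ → ℂ} (hF0 : ∀ n, (F n).eval 0 ≠ 0)
    (hb : ∀ n, F n = Polynomial.C ((F n).eval 0) *
      ∏ j ∈ Finset.range (N n), (1 - Polynomial.C (b n j) * Polynomial.X)) (k : ℕ) (hk : 1 ≤ k) :
    ∃ S, Tendsto (fun n => ∑ j ∈ Finset.range (N n), b n j ^ k) atTop (𝓝 S) := by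
  obtain ⟨m, rfl⟩ : ∃ m, k = m + 1 := ⟨k - 1, by omega⟩
  clear hk
  induction m using Nat.strong_induction_on with
  | _ m ih =>
    have hsum : ∃ T, Tendsto (fun n => ∑ i ∈ Finset.range m, (F n).coeff (i + 1) *
        ∑ j ∈ Finset.range (N n), b n j ^ (m - (i + 1) + 1)) atTop (𝓝 T) := by
      choose! S hS using ih
      refine ⟨∑ i ∈ Finset.range m, c (i + 1) * S (m - (i + 1)), tendsto_finsetSum _ fun i hi => ?_⟩
      have := Finset.mem_range.1 hi
      exact (hF _).mul (hS _ (by omega))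
    obtain ⟨T, hT⟩ := hsum
    refine ⟨(-(c (m + 1) * (m + 1)) - T) / c 0, ?_⟩
    refine Tendsto.congr (fun n => ?_) ((((hF (m + 1)).mul_const _).neg.sub hT).div (hF 0) hc)
    have h0 : (F n).coeff 0 ≠ 0 := by rw [Polynomial.coeff_zero_eq_eval_zero]; exact hF0 n
    have := newton_of_eq_prod (hb n) m
    -- The term `i = 0` carries the highest power sum, multiplied by the constant coefficient; the
    -- identity is solved for it, and the limit of the divisor is `c 0 ≠ 0`.
    rw [Finset.sum_range_succ', Nat.sub_zero] at this
    rw [Pi.div_apply, div_eq_iff h0]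
    linear_combination -this

/-- With `w = b ^ p`, `|w| ^ 2 = 2 (Re w) ^ 2 - Re (w ^ 2)`; for nonnegative reals the sum of
squares is at most the square of the sum. This is where the half-plane condition yields the bound.
-/
theorem sum_norm_pow_two_mul_le (p : ℕ) (s : Finset ℕ) (b : ℕ → ℂ)
    (hb : ∀ j ∈ s, 0 ≤ (b j ^ p).re) :
    ∑ j ∈ s, ‖b j‖ ^ (2 * p) ≤ 2 * ‖∑ j ∈ s, b j ^ p‖ ^ 2 + ‖∑ j ∈ s, b j ^ (2 * p)‖ := by
  have h1 : ∀ j, ‖b j‖ ^ (2 * p) = 2 * (b j ^ p).re ^ 2 - (b j ^ (2 * p)).re := fun j => by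
    rw [mul_comm 2 p, pow_mul, ← norm_pow, pow_mul, Complex.sq_norm, Complex.normSq_apply,
      sq (b j ^ p), Complex.mul_re]
    ring
  have h2 : ∑ j ∈ s, (b j ^ p).re ^ 2 ≤ (∑ j ∈ s, (b j ^ p).re) ^ 2 :=
    Finset.sum_sq_le_sq_sum_of_nonneg hb
  have h3 : (∑ j ∈ s, (b j ^ p).re) ^ 2 ≤ ‖∑ j ∈ s, b j ^ p‖ ^ 2 := by
    rw [← Complex.re_sum, ← sq_abs]
    gcongr
    exact Complex.abs_re_le_norm _
  have h4 : -(∑ j ∈ s, b j ^ (2 * p)).re ≤ ‖∑ j ∈ s, b j ^ (2 * p)‖ :=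
    (neg_le_abs _).trans (Complex.abs_re_le_norm _)
  rw [Complex.re_sum] at h4
  simp only [h1, Finset.sum_sub_distrib, ← Finset.mul_sum]
  linarith

theorem norm_le_add_one_of_sum_le {q : ℕ} (hq : q ≠ 0) {s : Finset ℕ} {b : ℕ → ℂ} {M : ℝ}
    (hM : ∑ j ∈ s, ‖b j‖ ^ q ≤ M) {j : ℕ} (hj : j ∈ s) : ‖b j‖ ≤ M + 1 := by
  have h0 : 0 ≤ M := (Finset.sum_nonneg fun _ _ => by positivity).trans hM
  have h1 : ‖b j‖ ^ q ≤ M :=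
    (Finset.single_le_sum (f := fun j => ‖b j‖ ^ q) (fun _ _ => by positivity) hj).trans hM
  refine le_of_pow_le_pow_left₀ hq (by linarith) (h1.trans ?_)
  exact (by linarith : M ≤ M + 1).trans (le_self_pow₀ (by linarith) hq)

/-- Polynomials whose inverse roots have bounded power sums are locally uniformly bounded. -/
theorem exists_norm_eval_le {F : ℕ → Polynomial ℂ} {N : ℕ → ℕ} {b : ℕ → ℕ → ℂ} {h : ℕ} {M A : ℝ}
    (hb : ∀ n, F n = Polynomial.C ((F n).eval 0) *
      ∏ j ∈ Finset.range (N n), (1 - Polynomial.C (b n j) * Polynomial.X))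
    (hA : ∀ n, ‖(F n).eval 0‖ ≤ A) (hM : ∀ n, ∑ j ∈ Finset.range (N n), ‖b n j‖ ^ (h + 1) ≤ M)
    (hS : ∀ k, 1 ≤ k → ∃ B, 0 ≤ B ∧ ∀ n, ‖∑ j ∈ Finset.range (N n), b n j ^ k‖ ≤ B) (R : ℝ)
    (hR : 0 ≤ R) :
    ∃ B, ∀ n, ∀ z : ℂ, ‖z‖ ≤ R → ‖(F n).eval z‖ ≤ B := by
  choose! B hB0 hB using hS
  obtain ⟨K, hK0, hK⟩ := exists_norm_elementaryFactor_sub_one_le h (R * (M + 1))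
  refine ⟨A * (Real.exp (∑ k ∈ Finset.Icc 1 h, B k * R ^ k / k) *
    Real.exp (K * R ^ (h + 1) * M)), fun n z hz => ?_⟩
  have hev : (F n).eval z = (F n).eval 0 * ∏ j ∈ Finset.range (N n), (1 - z * b n j) := by
    conv_lhs => rw [hb n]
    simp only [Polynomial.eval_mul, Polynomial.eval_C, Polynomial.eval_prod, Polynomial.eval_sub,
      Polynomial.eval_one, Polynomial.eval_X, mul_comm z]
  rw [hev, prod_one_sub_eq_exp_mul_prod_elementaryFactor h, norm_mul, norm_mul]
  have h0 : 0 ≤ A := (norm_nonneg _).trans (hA n)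
  gcongr
  · exact hA n
  · refine (Complex.norm_exp_le_exp_norm _).trans (Real.exp_le_exp.2 ?_)
    rw [norm_neg]
    refine (norm_sum_le _ _).trans (Finset.sum_le_sum fun k hk => ?_)
    have hk1 := (Finset.mem_Icc.1 hk).1
    rw [norm_div, norm_mul, norm_pow, Complex.norm_natCast]
    have := hB0 k hk1
    gcongr
    exact hB k hk1 n
  · rw [norm_prod]
    calc ∏ j ∈ Finset.range (N n), ‖elementaryFactor h (z * b n j)‖
        ≤ ∏ j ∈ Finset.range (N n), Real.exp (K * (R ^ (h + 1) * ‖b n j‖ ^ (h + 1))) := by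
          refine Finset.prod_le_prod (fun _ _ => norm_nonneg _) fun j hj => ?_
          have hbj := norm_le_add_one_of_sum_le h.succ_ne_zero (hM n) hj
          have hw : ‖z * b n j‖ ≤ R * (M + 1) := by rw [norm_mul]; gcongr
          have h1 := hK _ hw
          have h2 : ‖z * b n j‖ ^ (h + 1) ≤ R ^ (h + 1) * ‖b n j‖ ^ (h + 1) := by
            rw [norm_mul, mul_pow]; gcongr
          have h3 := norm_sub_norm_le (elementaryFactor h (z * b n j)) 1
          rw [norm_one] at h3
          have h4 := mul_le_mul_of_nonneg_left h2 hK0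
          have h5 := Real.add_one_le_exp (K * (R ^ (h + 1) * ‖b n j‖ ^ (h + 1)))
          linarith
      _ ≤ Real.exp (K * R ^ (h + 1) * M) := by
          rw [← Real.exp_sum, ← Finset.mul_sum, ← Finset.mul_sum, ← mul_assoc]
          gcongr
          exact hM n

/-- A locally uniformly bounded sequence of polynomials whose coefficients converge converges
uniformly on compact sets to the entire function given by the limit coefficients. -/
theorem exists_represents_and_stronglyConverges {F : ℕ → Polynomial ℂ} {f : PowerSeries ℂ}
    (hF : ∀ k, Tendsto (fun n => (F n).coeff k) atTop (𝓝 (PowerSeries.coeff k f)))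
    (hbd : ∀ R : ℝ, 0 ≤ R → ∃ B, ∀ n, ∀ z : ℂ, ‖z‖ ≤ R → ‖(F n).eval z‖ ≤ B) :
    ∃ φ : ℂ → ℂ, Represents f φ ∧ StronglyConverges (fun n z => (F n).eval z) φ := by
  have hcoef : ∀ R : ℝ, 0 < R → ∃ B, 0 ≤ B ∧ ∀ k,
      (∀ n, ‖(F n).coeff k‖ * R ^ k ≤ B * (1 / 2) ^ k) ∧
      ‖PowerSeries.coeff k f‖ * R ^ k ≤ B * (1 / 2) ^ k := by
    intro R hR
    -- Cauchy's estimate on the doubled radius gives the geometric majorant `(1 / 2) ^ k` at radius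
    -- `R`.
    obtain ⟨B, hB⟩ := hbd (2 * R) (by positivity)
    have h1 : ∀ k n, ‖(F n).coeff k‖ * R ^ k ≤ B * (1 / 2) ^ k := fun k n => by
      have := norm_coeff_le_of_norm_eval_le (F n) (by positivity) (hB n) k
      calc ‖(F n).coeff k‖ * R ^ k ≤ B / (2 * R) ^ k * R ^ k := by gcongr
        _ = B * (1 / 2) ^ k := by rw [mul_pow, one_div, inv_pow]; field_simp
    refine ⟨B, (norm_nonneg _).trans (hB 0 0 (by simpa using hR.le)), fun k => ⟨h1 k, ?_⟩⟩
    exact le_of_tendsto ((hF k).norm.mul_const _) (Eventually.of_forall (h1 k))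
  have hgeo : Summable fun k : ℕ => (1 / 2 : ℝ) ^ k :=
    summable_geometric_of_lt_one (by norm_num) (by norm_num)
  have hsumm : ∀ z : ℂ, Summable fun k => PowerSeries.coeff k f * z ^ k := fun z => by
    obtain ⟨B, _, hB⟩ := hcoef (‖z‖ + 1) (by positivity)
    refine (hgeo.mul_left B).of_norm_bounded fun k => (hB k).2.trans' ?_
    rw [norm_mul, norm_pow]
    gcongr
    linarith
  have hstrong : StronglyConverges (fun n z => (F n).eval z)
      fun z => ∑' k, PowerSeries.coeff k f * z ^ k := by
    intro K hK
    obtain ⟨R, hR0, hKR⟩ : ∃ R : ℝ, 0 < R ∧ ∀ z ∈ K, ‖z‖ ≤ R := by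
      obtain ⟨R, hR⟩ := hK.isBounded.exists_norm_le
      exact ⟨max R 1, by positivity, fun z hz => (hR z hz).trans (le_max_left _ _)⟩
    obtain ⟨B, hB0, hB⟩ := hcoef R hR0
    have hbound : ∀ n k, ‖(F n).coeff k - PowerSeries.coeff k f‖ * R ^ k ≤
        2 * B * (1 / 2) ^ k := fun n k => by
      have := norm_sub_le ((F n).coeff k) (PowerSeries.coeff k f)
      calc _ ≤ (‖(F n).coeff k‖ + ‖PowerSeries.coeff k f‖) * R ^ k := by gcongr
        _ ≤ _ := by linarith [(hB k).1 n, (hB k).2]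
    have hlim : Tendsto (fun n => ∑' k, ‖(F n).coeff k - PowerSeries.coeff k f‖ * R ^ k) atTop
        (𝓝 (∑' _ : ℕ, (0 : ℝ))) := by
      refine tendsto_tsum_of_dominated_convergence (hgeo.mul_left (2 * B)) (fun k => ?_)
        (Eventually.of_forall fun n k => ?_)
      · simpa using ((hF k).sub_const (PowerSeries.coeff k f)).norm.mul_const (R ^ k)
      · rw [Real.norm_of_nonneg (by positivity)]
        exact hbound n k
    rw [tsum_zero] at hlim
    rw [Metric.tendstoUniformlyOn_iff]
    intro ε hε
    filter_upwards [hlim.eventually_lt_const hε] with n hn z hz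
    have hev : HasSum (fun k => (F n).coeff k * z ^ k) ((F n).eval z) := by
      rw [Polynomial.eval_eq_sum]
      exact hasSum_sum_of_ne_finset_zero fun k hk => by
        rw [Polynomial.notMem_support_iff.1 hk, zero_mul]
    rw [dist_comm, dist_eq_norm, ← (hev.sub (hsumm z).hasSum).tsum_eq]
    have hs : Summable fun k => ‖(F n).coeff k - PowerSeries.coeff k f‖ * R ^ k :=
      (hgeo.mul_left (2 * B)).of_nonneg_of_le (fun k => by positivity) (hbound n)
    refine (tsum_of_norm_bounded hs.hasSum fun k => ?_).trans_lt hn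
    rw [← sub_mul, norm_mul, norm_pow]
    gcongr
    exact hKR z hz
  refine ⟨_, ⟨?_, fun z => (hsumm z).hasSum⟩, hstrong⟩
  have hloc : TendstoLocallyUniformlyOn (fun n z => (F n).eval z)
      (fun z => ∑' k, PowerSeries.coeff k f * z ^ k) atTop Set.univ :=
    (tendstoLocallyUniformlyOn_iff_forall_isCompact isOpen_univ).2 fun K _ hK => hstrong K hK
  exact differentiableOn_univ.1 (hloc.differentiableOn
    (Eventually.of_forall fun n => (F n).differentiable.differentiableOn) isOpen_univ)

/-! ### Limits of inverse roots and of their products -/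

theorem exists_subseq_tendsto_pointwise {b : ℕ → ℕ → ℂ} {B : ℝ} (hB : ∀ n j, ‖b n j‖ ≤ B) :
    ∃ (β : ℕ → ℂ) (σ : ℕ → ℕ), StrictMono σ ∧
      ∀ j, Tendsto (fun n => b (σ n) j) atTop (𝓝 (β j)) := by
  obtain ⟨β, -, σ, hσ, h⟩ := (isCompact_univ_pi fun _ : ℕ =>
    isCompact_closedBall (0 : ℂ) B).tendsto_subseq (x := b)
    fun n j _ => mem_closedBall_zero_iff.2 (hB n j)
  exact ⟨β, σ, hσ, fun j => (tendsto_pi_nhds.1 h) j⟩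

theorem sum_range_norm_pow_le {b : ℕ → ℂ} {q N : ℕ} (hq : q ≠ 0) {M : ℝ}
    (hb0 : ∀ j, N ≤ j → b j = 0) (hM : ∑ j ∈ Finset.range N, ‖b j‖ ^ q ≤ M) (K : ℕ) :
    ∑ j ∈ Finset.range K, ‖b j‖ ^ q ≤ M := by
  calc ∑ j ∈ Finset.range K, ‖b j‖ ^ q ≤ ∑ j ∈ Finset.range (max K N), ‖b j‖ ^ q :=
        Finset.sum_le_sum_of_subset_of_nonneg (Finset.range_mono (le_max_left _ _))
          fun _ _ _ => by positivity
    _ = ∑ j ∈ Finset.range N, ‖b j‖ ^ q := by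
        refine (Finset.sum_subset (Finset.range_mono (le_max_right _ _)) fun j _ hj => ?_).symm
        rw [hb0 j (not_lt.1 fun h => hj (Finset.mem_range.2 h)), norm_zero, zero_pow hq]
    _ ≤ M := hM

/-- Sorting gives `(j + 1) |b j| ^ q ≤ M`. The exponent `(q + 1) / q > 1` makes the bound summable
in `j`, and it depends on `b` only through `M`. -/
theorem norm_pow_succ_le_of_antitone {b : ℕ → ℂ} {q : ℕ} (hq : q ≠ 0) {M : ℝ}
    (hb : Antitone fun j => ‖b j‖) (hM : ∀ K, ∑ j ∈ Finset.range K, ‖b j‖ ^ q ≤ M) (j : ℕ) :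
    ‖b j‖ ^ (q + 1) ≤ (M / (j + 1)) ^ ((q + 1 : ℝ) / q) := by
  have hq' : (q : ℝ) ≠ 0 := by exact_mod_cast hq
  have h1 : ‖b j‖ ^ q ≤ M / (j + 1) := by
    rw [le_div_iff₀ (by positivity), mul_comm]
    calc ((j : ℝ) + 1) * ‖b j‖ ^ q = ∑ i ∈ Finset.range (j + 1), ‖b j‖ ^ q := by simp
      _ ≤ ∑ i ∈ Finset.range (j + 1), ‖b i‖ ^ q := by
          refine Finset.sum_le_sum fun i hi => ?_
          gcongr
          exact hb (Nat.lt_succ_iff.1 (Finset.mem_range.1 hi))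
      _ ≤ M := hM _
  calc ‖b j‖ ^ (q + 1) = (‖b j‖ ^ q) ^ ((q + 1 : ℝ) / q) := by
        rw [← Real.rpow_natCast_mul (norm_nonneg _), mul_div_cancel₀ _ hq', ← Real.rpow_natCast]
        push_cast
        rfl
    _ ≤ _ := Real.rpow_le_rpow (by positivity) h1 (by positivity)

theorem summable_div_add_one_rpow {M : ℝ} (hM : 0 ≤ M) {q : ℕ} (hq : q ≠ 0) :
    Summable fun j : ℕ => (M / ((j : ℝ) + 1)) ^ ((q + 1 : ℝ) / q) := by
  have hq' : (0 : ℝ) < q := by exact_mod_cast Nat.pos_of_ne_zero hq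
  have h := (summable_nat_add_iff 1).2 (Real.summable_one_div_nat_rpow.2
    (show (1 : ℝ) < (q + 1 : ℝ) / q by rw [lt_div_iff₀ hq']; linarith))
  refine (h.mul_left (M ^ ((q + 1 : ℝ) / q))).congr fun j => ?_
  rw [Real.div_rpow hM (by positivity)]
  push_cast
  ring

/-- If the sorted inverse roots of the polynomials `F n` have uniformly bounded `q`-th power sums,
then a pointwise limit of `F n` is a canonical product of rank `q` over limits of inverse roots. -/
theorem exists_limit_canonicalProduct {F : ℕ → Polynomial ℂ} {N : ℕ → ℕ} {b : ℕ → ℕ → ℂ} {q : ℕ}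
    (hq : q ≠ 0) {M : ℝ} {c : ℂ} {S : ℕ → ℂ} {T : Set ℂ} (hT : IsClosed T) (hbT : ∀ n j, b n j ∈ T)
    (hb0 : ∀ n j, N n ≤ j → b n j = 0) (hanti : ∀ n, Antitone fun j => ‖b n j‖)
    (hb : ∀ n, F n = Polynomial.C ((F n).eval 0) *
      ∏ j ∈ Finset.range (N n), (1 - Polynomial.C (b n j) * Polynomial.X))
    (hc : Tendsto (fun n => (F n).eval 0) atTop (𝓝 c))
    (hM : ∀ n, ∑ j ∈ Finset.range (N n), ‖b n j‖ ^ q ≤ M)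
    (hS : ∀ k, 1 ≤ k → Tendsto (fun n => ∑ j ∈ Finset.range (N n), b n j ^ k) atTop (𝓝 (S k)))
    {φ : ℂ → ℂ} (hφ : ∀ z, Tendsto (fun n => (F n).eval z) atTop (𝓝 (φ z))) :
    ∃ β : ℕ → ℂ, (∀ j, β j ∈ T) ∧ Summable (fun j => ‖β j‖ ^ q) ∧
      ∀ z, φ z = c * (Complex.exp (-∑ k ∈ Finset.Icc 1 q, S k * z ^ k / (k : ℂ)) *
        ∏' j, elementaryFactor q (z * β j)) := by
  have hM' := fun n => sum_range_norm_pow_le hq (hb0 n) (hM n)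
  have hM0 : 0 ≤ M := by simpa using hM' 0 0
  have hB : ∀ n j, ‖b n j‖ ≤ M + 1 := fun n j =>
    norm_le_add_one_of_sum_le hq (hM' n (j + 1)) (Finset.self_mem_range_succ j)
  obtain ⟨β, σ, hσ, hβ⟩ := exists_subseq_tendsto_pointwise hB
  refine ⟨β, fun j => hT.mem_of_tendsto (hβ j) (Eventually.of_forall fun n => hbT _ _), ?_,
    fun z => ?_⟩
  · exact summable_of_sum_range_le (c := M) (fun j => by positivity) fun K =>
      le_of_tendsto (tendsto_finsetSum _ fun j _ => (hβ j).norm.pow q)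
        (Eventually.of_forall fun n => hM' _ K)
  · obtain ⟨C, hC0, hC⟩ := exists_norm_elementaryFactor_sub_one_le q (‖z‖ * (M + 1))
    have hprod : Tendsto (fun n => ∏' j, (1 + (elementaryFactor q (z * b (σ n) j) - 1))) atTop
        (𝓝 (∏' j, (1 + (elementaryFactor q (z * β j) - 1)))) := by
      -- Rank `q` is used because bounded sums of `q`-th powers give only the majorant `M / (j +
      -- 1)`, which is not summable; one more power is needed.
      refine tendsto_tprod_one_add_of_dominated_convergence
        ((summable_div_add_one_rpow hM0 hq).mul_left (C * ‖z‖ ^ (q + 1))) (fun j => ?_)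
        (Eventually.of_forall fun n j => ?_)
      · exact (((continuous_elementaryFactor q).tendsto _).comp ((hβ j).const_mul z)).sub_const 1
      · refine (hC _ ?_).trans ?_
        · rw [norm_mul]
          gcongr
          exact hB _ _
        · rw [norm_mul, mul_pow, mul_assoc]
          gcongr
          exact norm_pow_succ_le_of_antitone hq (hanti _) (hM' _) j
    simp only [add_sub_cancel] at hprod
    have hexp : Tendsto (fun n => Complex.exp (-∑ k ∈ Finset.Icc 1 q,
        (∑ j ∈ Finset.range (N n), b n j ^ k) * z ^ k / (k : ℂ))) atTop
        (𝓝 (Complex.exp (-∑ k ∈ Finset.Icc 1 q, S k * z ^ k / (k : ℂ)))) :=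
      (Complex.continuous_exp.tendsto _).comp (tendsto_finsetSum _ fun k hk =>
        ((hS k (Finset.mem_Icc.1 hk).1).mul_const _).div_const _).neg
    refine tendsto_nhds_unique ((hφ z).comp hσ.tendsto_atTop)
      (((hc.comp hσ.tendsto_atTop).mul ((hexp.comp hσ.tendsto_atTop).mul hprod)).congr fun n => ?_)
    have hev := congrArg (Polynomial.eval z) (hb (σ n))
    simp only [Polynomial.eval_mul, Polynomial.eval_C, Polynomial.eval_prod, Polynomial.eval_sub,
      Polynomial.eval_one, Polynomial.eval_X] at hev
    simp only [mul_comm _ z] at hev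
    simp only [Function.comp]
    rw [hev, prod_one_sub_eq_exp_mul_prod_elementaryFactor q,
      tprod_eq_prod (s := Finset.range (N (σ n)))]
    intro j hj
    rw [hb0 _ j (not_lt.1 fun h => hj (Finset.mem_range.2 h)), mul_zero, elementaryFactor_zero]

/-! ### Canonical products and their rank -/

theorem summable_norm_elementaryFactor_sub_one {h : ℕ} {β : ℕ → ℂ}
    (hβ : Summable fun j => ‖β j‖ ^ (h + 1)) (z : ℂ) :
    Summable fun j => ‖elementaryFactor h (z * β j) - 1‖ := by
  obtain ⟨C, hC0, hC⟩ :=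
    exists_norm_elementaryFactor_sub_one_le h (‖z‖ * ((∑' j, ‖β j‖ ^ (h + 1)) + 1))
  refine (hβ.mul_left (C * ‖z‖ ^ (h + 1))).of_nonneg_of_le (fun _ => norm_nonneg _) fun j => ?_
  refine (hC _ ?_).trans_eq (by rw [norm_mul, mul_pow, mul_assoc])
  rw [norm_mul]
  gcongr
  exact norm_le_add_one_of_sum_le h.succ_ne_zero
    (hβ.sum_le_tsum (Finset.range (j + 1)) fun _ _ => by positivity) (Finset.self_mem_range_succ j)

theorem hasProd_elementaryFactor {h : ℕ} {β : ℕ → ℂ} (hβ : Summable fun j => ‖β j‖ ^ (h + 1))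
    (z : ℂ) : HasProd (fun j => elementaryFactor h (z * β j))
      (∏' j, elementaryFactor h (z * β j)) := by
  have := multipliable_one_add_of_summable (summable_norm_elementaryFactor_sub_one hβ z)
  simp only [add_sub_cancel] at this
  exact this.hasProd

theorem exists_mul_eq_one_of_tprod_elementaryFactor_eq_zero {h : ℕ} {β : ℕ → ℂ}
    (hβ : Summable fun j => ‖β j‖ ^ (h + 1)) {z : ℂ}
    (hz : ∏' j, elementaryFactor h (z * β j) = 0) : ∃ j, z * β j = 1 := by
  by_contra! hne
  refine tprod_one_add_ne_zero_of_summable (f := fun j => elementaryFactor h (z * β j) - 1)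
    (fun j => ?_) (summable_norm_elementaryFactor_sub_one hβ z) (by simpa only [add_sub_cancel])
  rw [add_sub_cancel]
  exact elementaryFactor_ne_zero (hne j)

theorem tprod_elementaryFactor_succ {h : ℕ} {β : ℕ → ℂ} (hβ : Summable fun j => ‖β j‖ ^ (h + 1))
    (z : ℂ) : ∏' j, elementaryFactor (h + 1) (z * β j) =
      Complex.exp ((∑' j, β j ^ (h + 1)) / ((h + 1 : ℕ) : ℂ) * z ^ (h + 1)) *
        ∏' j, elementaryFactor h (z * β j) := by
  have hs : Summable fun j => β j ^ (h + 1) := .of_norm (by simpa only [norm_pow] using hβ)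
  have h1 := ((hs.hasSum.div_const ((h + 1 : ℕ) : ℂ)).mul_right (z ^ (h + 1))).cexp
  rw [mul_comm]
  refine Eq.trans (tprod_congr fun j => ?_) ((hasProd_elementaryFactor hβ z).mul h1).tprod_eq
  rw [elementaryFactor_succ, mul_pow, Function.comp, mul_comm (z ^ (h + 1)), mul_div_right_comm]

theorem hasHadamardProduct_of_summable {h : ℕ} {β : ℕ → ℂ}
    (hβ : Summable fun j => ‖β j‖ ^ (h + 1)) {Q : Polynomial ℂ} (hQ : Q.natDegree ≤ h) :
    HasHadamardProduct
      (fun z => Complex.exp (Q.eval z) * ∏' j, elementaryFactor h (z * β j)) h := by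
  -- Indices with `β j = 0` correspond to no zero and contribute the factor 1, so they are
  -- discarded.
  refine ⟨0, Q, {j // β j ≠ 0}, inferInstance, fun j => (β j)⁻¹, hQ, fun j => inv_ne_zero j.2, ?_,
    fun z => ⟨_, ?_, by rw [pow_zero, one_mul]⟩⟩
  · refine (hβ.comp_injective Subtype.val_injective).congr fun j => ?_
    simp
  · simp only [div_inv_eq_mul]
    refine (hasProd_subtype_iff_of_mulSupport_subset (s := {j | β j ≠ 0})
      (f := fun j => elementaryFactor h (z * β j)) fun j hj hj0 => hj ?_).2
      (hasProd_elementaryFactor hβ z)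
    simp only [hj0, mul_zero, elementaryFactor_zero]

theorem inv_pow_re_nonneg {z : ℂ} {p : ℕ} (hz : 0 ≤ (z ^ p).re) : 0 ≤ (z⁻¹ ^ p).re := by
  rw [inv_pow, Complex.inv_re]
  exact div_nonneg hz (Complex.normSq_nonneg _)

theorem genus_le_of_hasHadamardProduct {g : ℂ → ℂ} {h : ℕ} (hg : HasHadamardProduct g h) :
    genus g ≤ h :=
  iInf₂_le h hg

theorem exists_exp_mul_factorization {h : ℕ} {β : ℕ → ℂ} (hβ : Summable fun j => ‖β j‖ ^ (h + 1))
    {c : ℂ} (hc : c ≠ 0) {S : ℕ → ℂ} {φ : ℂ → ℂ}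
    (hφ : ∀ z, φ z = c * (Complex.exp (-∑ k ∈ Finset.Icc 1 (h + 1), S k * z ^ k / (k : ℂ)) *
        ∏' j, elementaryFactor (h + 1) (z * β j))) :
    ∃ (α : ℂ) (g : ℂ → ℂ), HasHadamardProduct g h ∧
      ∀ z, φ z = Complex.exp (α * z ^ (h + 1)) * g z := by
  -- `log c` absorbs the constant `c ≠ 0`; the term of degree `h + 1` is left for `α`.
  set Q : Polynomial ℂ := Polynomial.C (Complex.log c) -
    ∑ k ∈ Finset.Icc 1 h, Polynomial.C (S k / k) * Polynomial.X ^ k with hQ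
  have hdeg : Q.natDegree ≤ h := by
    refine (Polynomial.natDegree_sub_le _ _).trans (max_le (by simp) ?_)
    refine Polynomial.natDegree_sum_le_of_forall_le _ _ fun k hk => ?_
    exact (Polynomial.natDegree_C_mul_X_pow_le _ _).trans (Finset.mem_Icc.1 hk).2
  refine ⟨(∑' j, β j ^ (h + 1)) / ((h + 1 : ℕ) : ℂ) - S (h + 1) / ((h + 1 : ℕ) : ℂ), _,
    hasHadamardProduct_of_summable hβ hdeg, fun z => ?_⟩
  have hQz : Complex.exp (Q.eval z) =
      c * Complex.exp (-∑ k ∈ Finset.Icc 1 h, S k * z ^ k / (k : ℂ)) := by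
    rw [hQ, Polynomial.eval_sub, Polynomial.eval_C, Polynomial.eval_finsetSum, sub_eq_add_neg,
      Complex.exp_add, Complex.exp_log hc]
    congr 3
    refine Finset.sum_congr rfl fun k _ => ?_
    simp only [Polynomial.eval_mul, Polynomial.eval_C, Polynomial.eval_pow, Polynomial.eval_X]
    ring
  rw [hφ, tprod_elementaryFactor_succ hβ, hQz, Finset.sum_Icc_succ_top (by omega), neg_add,
    Complex.exp_add, sub_mul, sub_eq_add_neg, Complex.exp_add,
    mul_div_right_comm (S (h + 1)) (z ^ (h + 1))]
  ring

/-! ### Assembling the theorem -/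

theorem inverse_root_mem {P : Polynomial ℂ} {p N : ℕ} (hp : 0 < p) {b : ℕ → ℂ}
    (hP : P.eval 0 ≠ 0) (hb0 : ∀ j, N ≤ j → b j = 0)
    (hb : P = Polynomial.C (P.eval 0) *
      ∏ j ∈ Finset.range N, (1 - Polynomial.C (b j) * Polynomial.X))
    (hz : zeroSet (fun z => P.eval z) ⊆ rightHalfPlaneRoot p) (j : ℕ) :
    b j ∈ {w : ℂ | 0 ≤ (w ^ p).re} := by
  rw [Set.mem_ofPred_eq]
  by_cases hj : b j = 0
  · rw [hj, zero_pow hp.ne', Complex.zero_re]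
  · rw [← inv_inv (b j)]
    refine inv_pow_re_nonneg (hz ⟨fun h0 => hP (congrFun h0 0), ?_⟩)
    beta_reduce
    have hjN : j ∈ Finset.range N := Finset.mem_range.2 (not_le.1 fun h => hj (hb0 j h))
    rw [hb, Polynomial.eval_mul, Polynomial.eval_prod, Finset.prod_eq_zero hjN, mul_zero]
    simp [hj]

theorem exists_factorization_of_eval_zero_ne_zero (p : ℕ) (hp : 0 < p)
    (F : ℕ → Polynomial ℂ) (f : PowerSeries ℂ) (hF0 : ∀ n, (F n).eval 0 ≠ 0)
    (hF : ∀ k, Tendsto (fun n => (F n).coeff k) atTop (𝓝 (PowerSeries.coeff k f)))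
    (hc : PowerSeries.coeff 0 f ≠ 0)
    (hzeros : ∀ n, zeroSet (fun z => (F n).eval z) ⊆ rightHalfPlaneRoot p) :
    ∃ φ : ℂ → ℂ, Represents f φ ∧
      StronglyConverges (fun n z => (F n).eval z) φ ∧
      zeroSet φ ⊆ rightHalfPlaneRoot p ∧
      ∃ (α : ℂ) (g : ℂ → ℂ), Differentiable ℂ g ∧ genus g ≤ ((2 * p - 1 : ℕ) : ℕ∞) ∧
        ∀ z : ℂ, φ z = Complex.exp (α * z ^ (2 * p)) * g z := by
  choose N b hb0 hanti hb using fun n => exists_sorted_inverse_roots (F n) (hF0 n)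
  have hbT := fun n => inverse_root_mem hp (hF0 n) (hb0 n) (hb n) (hzeros n)
  choose! S hS using exists_tendsto_powerSum hF hc hF0 hb
  have hSb := fun k hk => exists_norm_le_of_tendsto (hS k hk)
  obtain ⟨h, hh⟩ : ∃ h, 2 * p = h + 1 := ⟨2 * p - 1, by omega⟩
  obtain ⟨M, hM⟩ : ∃ M, ∀ n, ∑ j ∈ Finset.range (N n), ‖b n j‖ ^ (h + 1) ≤ M := by
    obtain ⟨A, hA0, hA⟩ := hSb p hp
    obtain ⟨B, -, hB⟩ := hSb (2 * p) (by omega)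
    refine ⟨2 * A ^ 2 + B, fun n => ?_⟩
    rw [← hh]
    refine (sum_norm_pow_two_mul_le p _ _ fun j _ => hbT n j).trans ?_
    gcongr
    · exact hA n
    · exact hB n
  have hc0 : Tendsto (fun n => (F n).eval 0) atTop (𝓝 (PowerSeries.coeff 0 f)) := by
    simpa only [Polynomial.coeff_zero_eq_eval_zero] using hF 0
  obtain ⟨A, -, hA⟩ := exists_norm_le_of_tendsto hc0
  obtain ⟨φ, hrep, hstrong⟩ :=
    exists_represents_and_stronglyConverges hF (exists_norm_eval_le hb hA hM hSb)
  have hpt : ∀ z, Tendsto (fun n => (F n).eval z) atTop (𝓝 (φ z)) := fun z =>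
    (hstrong {z} isCompact_singleton).tendsto_at (Set.mem_singleton z)
  obtain ⟨β, hβT, hβ, hφ⟩ := exists_limit_canonicalProduct h.succ_ne_zero
    (isClosed_le continuous_const (Complex.continuous_re.comp (continuous_pow p)))
    hbT hb0 hanti hb hc0 hM hS hpt
  obtain ⟨α, g, hg, hφg⟩ := exists_exp_mul_factorization hβ hc hφ
  refine ⟨φ, hrep, hstrong, ?_, α, g, ?_, ?_, ?_⟩
  · rintro z ⟨-, hz⟩
    rw [hφ z, tprod_elementaryFactor_succ hβ] at hz
    have hz' := (mul_eq_zero.1 ((mul_eq_zero.1 ((mul_eq_zero.1 hz).resolve_left hc)).resolve_left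
      (Complex.exp_ne_zero _))).resolve_left (Complex.exp_ne_zero _)
    obtain ⟨j, hj⟩ := exists_mul_eq_one_of_tprod_elementaryFactor_eq_zero hβ hz'
    rw [eq_inv_of_mul_eq_one_left hj]
    exact inv_pow_re_nonneg (hβT j)
  · have hgφ : g = fun z => Complex.exp (-(α * z ^ (h + 1))) * φ z := by
      funext z
      rw [hφg, ← mul_assoc, ← Complex.exp_add, neg_add_cancel, Complex.exp_zero, one_mul]
    have hd := hrep.1
    rw [hgφ]
    fun_prop
  · rw [hh, Nat.add_sub_cancel]
    exact genus_le_of_hasHadamardProduct hg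
  · rwa [hh]

theorem theorem2p4 (p : ℕ) (hp : 0 < p) (F : ℕ → Polynomial ℂ) (f : PowerSeries ℂ)
    (hweak : WeaklyConverges F f)
    (c : ℂ) (hlim : Tendsto (fun n => (F n).eval 0) atTop (𝓝 c)) (hc : c ≠ 0)
    (hzeros : ∀ n, zeroSet (fun z => (F n).eval z) ⊆ rightHalfPlaneRoot p) :
    ∃ φ : ℂ → ℂ, Represents f φ ∧
      StronglyConverges (fun n z => (F n).eval z) φ ∧
      zeroSet φ ⊆ rightHalfPlaneRoot p ∧
      ∃ (α : ℂ) (g : ℂ → ℂ), Differentiable ℂ g ∧ genus g ≤ ((2 * p - 1 : ℕ) : ℕ∞) ∧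
        ∀ z : ℂ, φ z = Complex.exp (α * z ^ (2 * p)) * g z := by
  have hcoeff : ∀ k, Tendsto (fun n => (F n).coeff k) atTop (𝓝 (PowerSeries.coeff k f)) := by
    intro k
    have hk : (k.factorial : ℂ) ≠ 0 := by exact_mod_cast k.factorial_ne_zero
    have := (hweak k).const_mul (k.factorial : ℂ)⁻¹
    simpa only [iteratedDeriv_eval_zero, inv_mul_cancel_left₀ hk] using this
  have hc0 : PowerSeries.coeff 0 f = c := by
    refine tendsto_nhds_unique (hcoeff 0) ?_
    simpa only [Polynomial.coeff_zero_eq_eval_zero] using hlim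
  -- Constant terms are nonzero only from some index on, so the argument runs on a tail, which has
  -- the same limits.
  obtain ⟨n₀, hn₀⟩ := eventually_atTop.1 (hlim.eventually_ne hc)
  obtain ⟨φ, hrep, hstrong, hrest⟩ := exists_factorization_of_eval_zero_ne_zero p hp
    (fun n => F (n + n₀)) f
    (fun n => hn₀ _ (Nat.le_add_left _ _))
    (fun k => (tendsto_add_atTop_iff_nat (f := fun n => (F n).coeff k) n₀).2 (hcoeff k))
    (hc0 ▸ hc) fun n => hzeros _
  refine ⟨φ, hrep, fun K hK u hu => ?_, hrest⟩
  have := hstrong K hK u hu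
  rw [← map_add_atTop_eq_nat n₀]
  exact this
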